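/- Let $q$ be a prime power and $\mathbb{F}_q$ the field with $q$ elements. A $(v,N,d;k)_q$ constant dimension code (CDC) is a set of $N$ subspaces of $\mathbb{F}_q^v$, each of dimension $k$, such that $d_S(U,W)=\dim(U+W)-\dim(U\cap W)\ge d$ for all distinct members $U,W$; let $A_q(v,d;k)$ be the largest $N$ for which such a code exists. A (linear) $m\times n$ MRD code of minimum distance $\delta$ is a linear subspace $M\le\mathbb{F}_q^{m\times n}$ with $\operatorname{rk}(A-B)\ge\delta$ for all distinct $A,B\in M$ and $\#M=\lceil q^{\max\{m,n\}(\min\{m,n\}-\delta+1)}\rceil$. For even $d$, a lifted MRD (LMRD) code with parameters $(v,d;k)$ is a set $\{\operatorname{rowspan}(I_k\mid A): A\in M\}$, where $M$ is a $k\times(v-k)$ MRD code of minimum distance $d/2$. For every integer $l\ge 1$ and every prime power $q$ there is a $$(6l,\;q^{3l(l+1)}+q^{2l}+q^l+1,\;4l;\;3l)_q$$ CDC that contains an LMRD code with parameters $(6l,4l;3l)$. This cardinality achieves the upper bound $q^{(v-k)(k-d/2+1)}+A_q(v-k,2(d-k);d/2)$ on the size of a $(v,\cdot,d;k)_q$ CDC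 containing an LMRD code, at $(v,d,k)=(6l,4l,3l)$. That is, $$q^{3l(l+1)}+q^{2l}+q^l+1 = q^{3l(l+1)}+A_q(3l,2l;2l),$$ and every $(6l,N,4l;3l)_q$ CDC that contains an LMRD code with parameters $(6l,4l;3l)$ satisfies $N\le q^{3l(l+1)}+A_q(3l,2l;2l)$. -/

import Mathlib

namespace SubspaceCode

/-- The subspace distance `dim (U + W) - dim (U ∩ W)`. -/
noncomputable def subspaceDist {F V : Type*} [Field F] [AddCommGroup V] [Module F V]
    (U W : Submodule F V) : ℕ :=
  Module.finrank F ↥(U ⊔ W) - Module.finrank F ↥(U ⊓ W)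

/-- `C` is a `(v, N, d; k)_q` constant dimension code, where `q` is the size of the finite field
`F`: a set of `N` subspaces of `F ^ v`, all of dimension `k`, with pairwise subspace distance at
least `d`. -/
structure IsCDC (F : Type*) [Field F] (v N d k : ℕ) (C : Set (Submodule F (Fin v → F))) :
    Prop where
  ncard_eq : C.ncard = N
  finrank_eq : ∀ U ∈ C, Module.finrank F ↥U = k
  le_dist : ∀ U ∈ C, ∀ W ∈ C, U ≠ W → d ≤ subspaceDist U W

/-- `A_q(v, d; k)`: the maximum cardinality of a `(v, N, d; k)_q` constant dimension code,
where `q` is the size of the finite field `F`. -/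
noncomputable def maxCDCSize (F : Type*) [Field F] (v d k : ℕ) : ℕ :=
  sSup {N | ∃ C : Set (Submodule F (Fin v → F)), IsCDC F v N d k C}

/-- Over a finite field the supremum defining `A_q(v, d; k)` is an attained maximum. -/
theorem isGreatest_maxCDCSize (F : Type*) [Field F] [Finite F] (v d k : ℕ) :
    IsGreatest {N | ∃ C : Set (Submodule F (Fin v → F)), IsCDC F v N d k C}
      (maxCDCSize F v d k) := by
  have : Finite (Submodule F (Fin v → F)) :=
    Finite.of_injective (fun U : Submodule F (Fin v → F) => (U : Set (Fin v → F)))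
      SetLike.coe_injective
  have hb : BddAbove {N | ∃ C : Set (Submodule F (Fin v → F)), IsCDC F v N d k C} := by
    refine ⟨Nat.card (Submodule F (Fin v → F)), ?_⟩
    rintro N ⟨C, hC⟩
    rw [← hC.ncard_eq]
    exact Set.ncard_le_card C
  refine ⟨Nat.sSup_mem ⟨0, ∅, ?_⟩ hb, fun N hN => le_csSup hb hN⟩
  exact ⟨Set.ncard_empty _, by simp, by simp⟩

/-- `M` is a linear `[m × n, #M, d]_q` rank metric code: a linear subspace of the space of
`m × n` matrices whose distinct elements have rank distance at least `d`. -/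
def IsRankMetricCode {F : Type*} [Field F] {m n : ℕ}
    (M : Submodule F (Matrix (Fin m) (Fin n) F)) (d : ℕ) : Prop :=
  ∀ A ∈ M, ∀ B ∈ M, A ≠ B → d ≤ (A - B).rank

/-- `M` is a linear maximum rank distance code of minimum distance (at least) `d`: a linear rank
metric code of the maximum cardinality `⌈q ^ (max m n * (min m n - d + 1))⌉`. The exponent is an
integer and may be negative. -/
def IsMRD {F : Type*} [Field F] {m n : ℕ}
    (M : Submodule F (Matrix (Fin m) (Fin n) F)) (d : ℕ) : Prop :=
  IsRankMetricCode M d ∧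
    Nat.card ↥M =
      ⌈(Nat.card F : ℚ) ^ (((max m n : ℕ) : ℤ) * (((min m n : ℕ) : ℤ) - (d : ℤ) + 1))⌉₊

/-- The `k × v` matrix `(I_k | A)`. -/
def prefixIdentity {F : Type*} [Field F] {v k : ℕ} (A : Matrix (Fin k) (Fin (v - k)) F) :
    Matrix (Fin k) (Fin v) F :=
  Matrix.of fun i j =>
    if h : (j : ℕ) < k then (1 : Matrix (Fin k) (Fin k) F) i ⟨j, h⟩
    else A i ⟨(j : ℕ) - k, by have := j.isLt; omega⟩

/-- The span of the rows of a matrix. -/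
def rowspan {F : Type*} [Field F] {k v : ℕ} (A : Matrix (Fin k) (Fin v) F) :
    Submodule F (Fin v → F) :=
  Submodule.span F (Set.range A.row)

/-- `L` is a lifted maximum rank distance code with parameters `v, d, k` (`d` even): the set of
row spans of `(I_k | A)`, for `A` in a linear `k × (v - k)` MRD code of minimum distance `d / 2`. -/
def IsLMRD (F : Type*) [Field F] (v d k : ℕ) (L : Set (Submodule F (Fin v → F))) : Prop :=
  ∃ M : Submodule F (Matrix (Fin k) (Fin (v - k)) F), IsMRD M (d / 2) ∧
    L = {U | ∃ A ∈ M, U = rowspan (prefixIdentity A)}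

/-- The code `C` contains a lifted maximum rank distance code with parameters `v, d, k`. -/
def ContainsLMRD (F : Type*) [Field F] (v d k : ℕ) (C : Set (Submodule F (Fin v → F))) : Prop :=
  ∃ L : Set (Submodule F (Fin v → F)), IsLMRD F v d k L ∧ L ⊆ C

/-- The right-hand side `q ^ ((v - k) (k - d/2 + 1)) + A_q(v - k, 2 (d - k); d / 2)` of the upper
bound for `(v, N, d; k)_q` codes containing a lifted MRD code
(`d` even, `2 ≤ d / 2 ≤ k ≤ v / 2`, `k < d`). -/
noncomputable def lmrdBound (F : Type*) [Field F] (v d k : ℕ) : ℕ :=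
  Nat.card F ^ ((v - k) * (k - d / 2 + 1)) + maxCDCSize F (v - k) (2 * (d - k)) (d / 2)

end SubspaceCode

/-! Split `F ^ (6 * l)` as `A × B` with both factors of dimension `3 * l`. Lifted matrices become
graphs of maps `A → B`, and distance at least `4 * l` means that codewords meet in dimension at most
`l`.

Upper bound: restricting an MRD code to a space `T` of dimension `l + 1` that meets `0 × B`
trivially is an injection between spaces of equal dimension, so `T` lies in a graph
(`exists_le_graph`). A further codeword contains no such `T`, hence meets `0 × B` in dimension at
least `2 * l` (`finrank_lt_add_finrank_comap_inr`). Subspaces of dimension `2 * l` chosen there meet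
pairwise in dimension at most `l`; their annihilators are disjoint `l`-spaces in dimension `3 * l`,
so counting nonzero vectors leaves at most `(q^(3l) - 1) / (q^l - 1) = q^(2l) + q^l + 1` of them.

Construction: to the lifted linearized polynomials add the spaces `Q × Q⊥`, for `Q` in a
Desarguesian spread of `A` and `Q⊥` its annihilator carried to `B`. Two of them meet in `0 × (Q +
Q')⊥`, of dimension `l`, and a graph meets `Q × Q⊥` in a space that projects injectively to `Q`. -/

namespace SubspaceCode

open Module

/-! ### Intersection dimensions and counting bounds. -/

section LinearAlgebra

theorem finrank_map_equiv_inf {F V V' : Type*} [Field F] [AddCommGroup V] [Module F V]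
    [AddCommGroup V'] [Module F V'] (e : V ≃ₗ[F] V')
    (U W : Submodule F V) :
    finrank F ↥(U.map e.toLinearMap ⊓ W.map e.toLinearMap) = finrank F ↥(U ⊓ W) := by
  rw [← Submodule.map_inf _ e.injective, LinearEquiv.finrank_map_eq]

variable {F V : Type*} [Field F] [AddCommGroup V] [Module F V] [FiniteDimensional F V]

theorem exists_le_finrank_eq (W : Submodule F V) {t : ℕ} (ht : t ≤ finrank F W) :
    ∃ T ≤ W, finrank F T = t := by
  let b := finBasis F W
  have hli : LinearIndependent F fun i : Fin t => (b (Fin.castLE ht i) : V) :=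
    (b.linearIndependent.comp _ (Fin.castLE_injective ht)).map' W.subtype W.ker_subtype
  refine ⟨Submodule.span F (Set.range fun i : Fin t => (b (Fin.castLE ht i) : V)), ?_, ?_⟩
  · rw [Submodule.span_le]
    rintro _ ⟨i, rfl⟩
    exact (b _).2
  · rw [finrank_span_eq_card hli, Fintype.card_fin]

theorem le_subspaceDist_iff {d k : ℕ} {U W : Submodule F V} (hU : finrank F U = k)
    (hW : finrank F W = k) : d ≤ subspaceDist U W ↔ d + 2 * finrank F ↥(U ⊓ W) ≤ 2 * k := by
  have h := Submodule.finrank_sup_add_finrank_inf_eq U W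
  have h' := Submodule.finrank_mono (inf_le_left : U ⊓ W ≤ U)
  unfold subspaceDist
  omega

theorem ncard_mul_le_of_pairwise_disjoint [Finite F] {l : ℕ} (D : Set (Submodule F V))
    (hD : ∀ U ∈ D, finrank F U = l) (hdisj : D.Pairwise Disjoint) :
    D.ncard * (Nat.card F ^ l - 1) ≤ Nat.card F ^ finrank F V - 1 := by
  have : Finite V := Module.finite_of_finite F
  have hcard : ∀ (W : Type _) [AddCommGroup W] [Module F W] [FiniteDimensional F W],
      Nat.card {x : W // x ≠ 0} = Nat.card F ^ finrank F W - 1 := by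
    intro W _ _ _
    have : Finite W := Module.finite_of_finite F
    rw [← Module.natCard_eq_pow_finrank (K := F) (V := W)]
    have := Set.ncard_compl ({0} : Set W)
    rw [Set.ncard_singleton] at this
    exact this
  have : Finite (Submodule F V) := Finite.of_injective _ SetLike.coe_injective
  have hfin : Fintype D := Fintype.ofFinite D
  let g : (Σ U : D, {x : (U : Submodule F V) // x ≠ 0}) → {x : V // x ≠ 0} :=
    fun p => ⟨p.2.1, fun h => p.2.2 (Subtype.ext h)⟩
  have hg : Function.Injective g := by
    rintro ⟨⟨U, hU⟩, ⟨⟨x, hx⟩, hx0⟩⟩ ⟨⟨W, hW⟩, ⟨⟨y, hy⟩, hy0⟩⟩ h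
    have hxy : x = y := congrArg Subtype.val h
    subst hxy
    have hUW : U = W := by
      by_contra hne
      exact hx0 (Subtype.ext ((Submodule.disjoint_def.1 (hdisj hU hW hne)) x hx hy))
    subst hUW
    rfl
  have h := Nat.card_le_card_of_injective g hg
  rw [Nat.card_sigma, hcard V] at h
  refine le_of_eq_of_le ?_ h
  rw [Finset.sum_congr rfl fun U _ => (hcard U.1).trans (by rw [hD U.1 U.2]), Finset.sum_const,
    Finset.card_univ, smul_eq_mul, ← Nat.card_eq_fintype_card, Nat.card_coe_set_eq]

/-- Two such spaces span `V`, so their annihilators are disjoint `l`-spaces of the dual, and these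
are bounded by counting nonzero vectors. -/
theorem ncard_le_of_finrank_inf_le [Finite F] {l : ℕ} (hl : 1 ≤ l) (hV : finrank F V = 3 * l)
    (D : Set (Submodule F V)) (hD : ∀ U ∈ D, finrank F U = 2 * l)
    (hinf : ∀ U ∈ D, ∀ W ∈ D, U ≠ W → finrank F ↥(U ⊓ W) ≤ l) :
    D.ncard ≤ Nat.card F ^ (2 * l) + Nat.card F ^ l + 1 := by
  have hann (U : Submodule F V) := Subspace.finrank_add_finrank_dualAnnihilator_eq (K := F) U
  have hinj : Function.Injective fun U : Submodule F V => U.dualAnnihilator :=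
    fun U W h => Subspace.dualAnnihilator_inj.1 h
  have h := ncard_mul_le_of_pairwise_disjoint (F := F) (V := Dual F V) (l := l)
    ((fun U : Submodule F V => U.dualAnnihilator) '' D) (by
      rintro _ ⟨U, hU, rfl⟩
      have := hann U
      have := hD U hU
      dsimp only
      omega) (by
      rintro _ ⟨U, hU, rfl⟩ _ ⟨W, hW, rfl⟩ hne
      have hUW : U ≠ W := fun h => hne (by rw [h])
      have h1 := Submodule.finrank_sup_add_finrank_inf_eq U W
      have h2 := hinf U hU W hW hUW
      rw [hD U hU, hD W hW] at h1
      have h3 := hann (U ⊔ W)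
      rw [disjoint_iff, ← Submodule.dualAnnihilator_sup_eq, ← Submodule.finrank_eq_zero (R := F)]
      omega)
  rw [Set.ncard_image_of_injective _ hinj, Subspace.dual_finrank_eq, hV] at h
  have hq : 1 < Nat.card F ^ l := Nat.one_lt_pow (by omega) Finite.one_lt_card
  have hm : Nat.card F ^ (2 * l) = (Nat.card F ^ l) ^ 2 := by rw [← pow_mul]; ring_nf
  rw [show 3 * l = l * 3 by ring, pow_mul] at h
  rw [hm]
  generalize Nat.card F ^ l = x at *
  -- With `x = q ^ l`, cancel `x - 1` from `x ^ 3 - 1 = (x ^ 2 + x + 1) * (x - 1)`.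
  obtain ⟨y, rfl⟩ : ∃ y, x = y + 1 := ⟨x - 1, by omega⟩
  rw [show (y + 1) ^ 3 - 1 = ((y + 1) ^ 2 + (y + 1) + 1) * y by
    rw [Nat.sub_eq_iff_eq_add (Nat.one_le_pow _ _ (by omega))]; ring, Nat.add_sub_cancel] at h
  exact Nat.le_of_mul_le_mul_right h (by omega)

end LinearAlgebra

/-! ### Linearized polynomials and spreads from extension fields. -/

section FieldExtension

theorem exists_extension_finrank_eq (F : Type*) [Field F] [Finite F] {n : ℕ} (hn : 1 ≤ n) :
    ∃ (K : Type) (_ : Field K) (_ : Algebra F K), Finite K ∧ finrank F K = n := by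
  obtain ⟨p, hp⟩ := CharP.exists F
  have : Fact p.Prime := ⟨CharP.char_is_prime F p⟩
  have : NeZero n := ⟨by omega⟩
  exact ⟨FiniteField.Extension F p n, inferInstance, inferInstance, inferInstance,
    FiniteField.finrank_extension F p n⟩

variable {F : Type*} [Field F] [Finite F]

/-- The linear code of linearized polynomials of `q`-degree less than `t`. -/
theorem exists_submodule_finrank_ker_lt {A B : Type*} [AddCommGroup A] [Module F A]
    [FiniteDimensional F A] [AddCommGroup B] [Module F B] [FiniteDimensional F B] {n t : ℕ}
    (hn : 1 ≤ n) (hA : finrank F A = n) (hB : finrank F B = n) (ht : t ≤ n) :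
    ∃ M : Submodule F (A →ₗ[F] B), finrank F M = t * n ∧
      ∀ f ∈ M, f ≠ 0 → finrank F (LinearMap.ker f) < t := by
  obtain ⟨K, _, _, _, hK⟩ := exists_extension_finrank_eq F hn
  have : Fintype F := Fintype.ofFinite F
  have : FiniteDimensional F K := FiniteDimensional.of_finrank_pos (by omega)
  let φ : K →ₐ[F] K := FiniteField.frobeniusAlgHom F K
  have hφ (i : ℕ) (x : K) : (φ ^ i) x = x ^ Nat.card F ^ i := by
    rw [AlgHom.coe_pow, FiniteField.coe_frobeniusAlgHom, pow_iterate, Nat.card_eq_fintype_card]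
  let G : (Fin t → K) →ₗ[F] K →ₗ[F] K :=
    LinearMap.lsum F (fun _ : Fin t => K) F fun i =>
      (LinearMap.lcomp F K (φ ^ (i : ℕ)).toLinearMap).comp (LinearMap.mul F K)
  have hG (a : Fin t → K) (x : K) : G a x = ∑ i : Fin t, a i * x ^ Nat.card F ^ (i : ℕ) := by
    simp [G, LinearMap.lsum_apply, hφ]
  -- The kernel consists of roots of a nonzero polynomial of degree at most `q ^ (t - 1)`, so its
  -- dimension is at most `t - 1`.
  have hker (a : Fin t → K) (ha : a ≠ 0) : finrank F (LinearMap.ker (G a)) < t := by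
    open Polynomial in
    obtain ⟨j, hj⟩ := Function.ne_iff.1 ha
    have hq : 1 < Nat.card F := Finite.one_lt_card
    let P : K[X] := ∑ i : Fin t, C (a i) * X ^ Nat.card F ^ (i : ℕ)
    have hcoeff : P.coeff (Nat.card F ^ (j : ℕ)) = a j := by
      simp only [P, finsetSum_coeff, coeff_C_mul, coeff_X_pow]
      rw [Finset.sum_eq_single j]
      · simp
      · intro i _ hij
        rw [if_neg, mul_zero]
        intro h
        exact hij (Fin.ext (Nat.pow_right_injective hq h.symm))
      · simp
    have hP : P ≠ 0 := by
      rintro h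
      rw [h, coeff_zero] at hcoeff
      exact hj hcoeff.symm
    have hdeg : P.natDegree ≤ Nat.card F ^ (t - 1) := by
      refine natDegree_sum_le_of_forall_le _ _ fun i _ => ?_
      refine (natDegree_C_mul_X_pow_le _ _).trans (Nat.pow_le_pow_right (by omega) ?_)
      have := i.2
      omega
    classical
    have hsub : (LinearMap.ker (G a) : Set K) ⊆ (P.roots.toFinset : Set K) := by
      intro x hx
      rw [SetLike.mem_coe, LinearMap.mem_ker, hG] at hx
      rw [Finset.mem_coe, Multiset.mem_toFinset, mem_roots hP, IsRoot, eval_finsetSum]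
      simpa using hx
    have hcard : Nat.card F ^ finrank F (LinearMap.ker (G a)) ≤ Nat.card F ^ (t - 1) := by
      rw [← Module.natCard_eq_pow_finrank (K := F)]
      calc Nat.card (LinearMap.ker (G a))
          = (LinearMap.ker (G a) : Set K).ncard := Nat.card_coe_set_eq _
        _ ≤ P.roots.toFinset.card := by
            rw [← Set.ncard_coe_finset]
            exact Set.ncard_le_ncard hsub (Finset.finite_toSet _)
        _ ≤ P.natDegree := (Multiset.toFinset_card_le _).trans (card_roots' _)
        _ ≤ _ := hdeg
    have := (Nat.pow_le_pow_iff_right hq).1 hcard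
    have := j.2
    omega
  have hGinj : Function.Injective G := by
    rw [← LinearMap.ker_eq_bot, LinearMap.ker_eq_bot']
    intro a ha
    by_contra hne
    have := hker a hne
    rw [ha, LinearMap.ker_zero, finrank_top] at this
    omega
  let eA : A ≃ₗ[F] K := LinearEquiv.ofFinrankEq _ _ (hA.trans hK.symm)
  let eB : K ≃ₗ[F] B := LinearEquiv.ofFinrankEq _ _ (hK.trans hB.symm)
  let e : (K →ₗ[F] K) ≃ₗ[F] (A →ₗ[F] B) := eA.symm.arrowCongr eB
  refine ⟨(LinearMap.range G).map e.toLinearMap, ?_, ?_⟩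
  · rw [LinearEquiv.finrank_map_eq, LinearMap.finrank_range_of_inj hGinj,
      Module.finrank_pi_fintype]
    simp [hK]
  · rintro _ ⟨_, ⟨a, rfl⟩, rfl⟩ hne
    have ha : a ≠ 0 := by
      rintro rfl
      simp at hne
    refine lt_of_eq_of_lt ?_ (hker a ha)
    have : LinearMap.ker (e (G a)) = (LinearMap.ker (G a)).map eA.symm.toLinearMap := by
      ext x
      rw [Submodule.mem_map_equiv]
      simp [e, LinearEquiv.arrowCongr_apply]
    exact this ▸ LinearEquiv.finrank_map_eq eA.symm _

/-- The Desarguesian `l`-spread of a space of dimension `3 * l`. -/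
theorem exists_spread {V : Type*} [AddCommGroup V] [Module F V] [FiniteDimensional F V] {l : ℕ}
    (hl : 1 ≤ l) (hV : finrank F V = 3 * l) :
    ∃ (ι : Type) (Q : ι → Submodule F V), Finite ι ∧
      Nat.card ι = Nat.card F ^ (2 * l) + Nat.card F ^ l + 1 ∧
      (∀ i, finrank F (Q i) = l) ∧ ∀ i j, i ≠ j → Disjoint (Q i) (Q j) := by
  obtain ⟨K, _, _, _, hK⟩ := exists_extension_finrank_eq F hl
  have : FiniteDimensional F K := FiniteDimensional.of_finrank_pos (by omega)
  let e : (Fin 3 → K) ≃ₗ[F] V := LinearEquiv.ofFinrankEq _ _ (by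
    rw [Module.finrank_pi_fintype, hV]; simp [hK])
  -- The spread elements are the points of the projective plane over `K`, read over `F`.
  refine ⟨Projectivization K (Fin 3 → K),
    fun p => (p.submodule.restrictScalars F).map e.toLinearMap, inferInstance, ?_, ?_, ?_⟩
  · rw [Projectivization.card_of_finrank K (Fin 3 → K) (n := 3) (by simp),
      Module.natCard_eq_pow_finrank (K := F) (V := K), hK, Finset.sum_range_succ,
      Finset.sum_range_succ, Finset.sum_range_one, ← pow_mul]
    ring
  · intro p
    rw [LinearEquiv.finrank_map_eq]
    have := Module.finrank_mul_finrank F K p.submodule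
    rw [p.finrank_submodule, hK, mul_one] at this
    exact this.symm
  · intro p p' hne
    refine Submodule.disjoint_map e.injective ?_
    have : Disjoint p.submodule p'.submodule := by
      rw [disjoint_iff, ← Submodule.finrank_eq_zero (R := K)]
      by_contra h
      have h1 := p.finrank_submodule
      have h2 := p'.finrank_submodule
      have h3 := Submodule.eq_of_le_of_finrank_le
        (inf_le_left : p.submodule ⊓ p'.submodule ≤ p.submodule) (by omega)
      have h4 := Submodule.eq_of_le_of_finrank_le
        (inf_le_right : p.submodule ⊓ p'.submodule ≤ p'.submodule) (by omega)
      exact hne (Projectivization.submodule_injective (h3.symm.trans h4))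
    rw [Submodule.disjoint_def] at this ⊢
    exact this

end FieldExtension

/-! ### Graphs of linear maps and their intersections. -/

section Graph

variable {F A B : Type*} [Field F] [AddCommGroup A] [Module F A]
  [AddCommGroup B] [Module F B]

theorem finrank_map_of_injective {f : A →ₗ[F] B} (hf : Function.Injective f)
    (W : Submodule F A) : finrank F (W.map f) = finrank F W :=
  (Submodule.equivMapOfInjective f hf W).finrank_eq.symm

theorem finrank_graph (f : A →ₗ[F] B) : finrank F f.graph = finrank F A := by
  rw [LinearMap.graph_eq_range_prod]
  exact LinearMap.finrank_range_of_inj fun x y h => congrArg Prod.fst h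

theorem finrank_graph_inf_graph (f g : A →ₗ[F] B) :
    finrank F ↥(f.graph ⊓ g.graph) = finrank F (LinearMap.ker (f - g)) := by
  have h : f.graph ⊓ g.graph = (LinearMap.ker (f - g)).map (LinearMap.id.prod f) := by
    ext ⟨x, y⟩
    rw [Submodule.mem_inf, LinearMap.mem_graph_iff, LinearMap.mem_graph_iff]
    constructor
    · rintro ⟨h1, h2⟩
      exact ⟨x, sub_eq_zero.2 (h1.symm.trans h2), Prod.ext rfl h1.symm⟩
    · rintro ⟨z, hz, h⟩
      obtain rfl : z = x := congrArg Prod.fst h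
      have h1 : f z = y := congrArg Prod.snd h
      exact ⟨h1.symm, h1.symm.trans (sub_eq_zero.1 hz)⟩
  rw [h, finrank_map_of_injective fun x y h => congrArg Prod.fst h]

theorem finrank_comap_inr (W : Submodule F (A × B)) :
    finrank F (W.comap (LinearMap.inr F A B)) =
      finrank F ↥(W ⊓ LinearMap.ker (LinearMap.fst F A B)) := by
  rw [← finrank_map_of_injective (f := LinearMap.inr F A B) LinearMap.inr_injective,
    Submodule.map_comap_eq, inf_comm, LinearMap.range_inr]

variable [FiniteDimensional F A] [FiniteDimensional F B]

theorem finrank_submodule_prod (Q : Submodule F A) (P : Submodule F B) :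
    finrank F (Q.prod P) = finrank F Q + finrank F P := by
  have h : Q.prod P = LinearMap.range (Q.subtype.prodMap P.subtype) := by
    rw [LinearMap.range_prodMap, Submodule.range_subtype, Submodule.range_subtype]
  rw [h, LinearMap.finrank_range_of_inj
    (Function.Injective.prodMap Q.injective_subtype P.injective_subtype), Module.finrank_prod]

/-- In a linear code of maximum cardinality the graphs cover every `t`-dimensional space that
meets `0 × B` trivially. -/
theorem exists_le_graph {t : ℕ} {M : Submodule F (A →ₗ[F] B)}
    (hM : finrank F M = t * finrank F B)
    (hker : ∀ f ∈ M, f ≠ 0 → finrank F (LinearMap.ker f) < t) {T : Submodule F (A × B)}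
    (hT : finrank F T = t) (hdisj : Disjoint T (LinearMap.ker (LinearMap.fst F A B))) :
    ∃ f ∈ M, T ≤ f.graph := by
  let π : T →ₗ[F] A := (LinearMap.fst F A B).comp T.subtype
  have hπ : Function.Injective π := by
    rw [← LinearMap.ker_eq_bot, LinearMap.ker_eq_bot']
    rintro ⟨x, hx⟩ h
    exact Subtype.ext (Submodule.disjoint_def.1 hdisj x hx h)
  let ρ : M →ₗ[F] T →ₗ[F] B := (LinearMap.lcomp F B π).comp M.subtype
  have hρ : Function.Injective ρ := by
    rw [← LinearMap.ker_eq_bot, LinearMap.ker_eq_bot']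
    rintro ⟨f, hf⟩ h
    by_contra hne
    have hlt := hker f hf fun h => hne (Subtype.ext h)
    -- A map restricting to zero vanishes on the `t`-dimensional projection of `T`, too much for a
    -- nonzero element of `M`.
    have hle : LinearMap.range π ≤ LinearMap.ker f := by
      rintro _ ⟨x, rfl⟩
      exact LinearMap.congr_fun h x
    have := Submodule.finrank_mono hle
    rw [LinearMap.finrank_range_of_inj hπ] at this
    omega
  have hsurj : Function.Surjective ρ :=
    (LinearMap.injective_iff_surjective_of_finrank_eq_finrank
      (by rw [hM, Module.finrank_linearMap, hT])).1 hρ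
  obtain ⟨⟨f, hf⟩, h⟩ := hsurj ((LinearMap.snd F A B).comp T.subtype)
  refine ⟨f, hf, fun x hx => ?_⟩
  rw [LinearMap.mem_graph_iff]
  exact (LinearMap.congr_fun h ⟨x, hx⟩).symm

/-- Otherwise a complement of `W ∩ (0 × B)` in `W` contains a `t`-space, which lies in some graph
from `M`; that graph then meets `W` in dimension at least `t`. -/
theorem finrank_lt_add_finrank_comap_inr {t : ℕ} {M : Submodule F (A →ₗ[F] B)}
    (hM : finrank F M = t * finrank F B)
    (hker : ∀ f ∈ M, f ≠ 0 → finrank F (LinearMap.ker f) < t) {W : Submodule F (A × B)}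
    (hW : ∀ f ∈ M, finrank F ↥(f.graph ⊓ W) < t) :
    finrank F W < t + finrank F (W.comap (LinearMap.inr F A B)) := by
  rw [finrank_comap_inr]
  set S := LinearMap.ker (LinearMap.fst F A B)
  by_contra! hle
  obtain ⟨W', hW'⟩ := (W ⊓ S).exists_isCompl
  have hmod : (W ⊓ S) ⊔ W' ⊓ W = W := by
    rw [← sup_inf_assoc_of_le _ inf_le_left, hW'.sup_eq_top, top_inf_eq]
  have hrank := Submodule.finrank_add_le_finrank_add_finrank (W ⊓ S) (W' ⊓ W)
  rw [hmod] at hrank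
  obtain ⟨T, hTW, hT⟩ := exists_le_finrank_eq (W' ⊓ W) (t := t) (by omega)
  have hdisj : Disjoint T S := by
    rw [Submodule.disjoint_def]
    intro x hx hxS
    exact Submodule.disjoint_def.1 hW'.disjoint x ⟨(hTW hx).2, hxS⟩ (hTW hx).1
  obtain ⟨f, hf, hTf⟩ := exists_le_graph hM hker hT hdisj
  have := Submodule.finrank_mono (le_inf hTf (hTW.trans inf_le_right))
  have := hW f hf
  omega

end Graph

/-! ### From matrices and row spans to linear maps and graphs. -/

section Matrix

variable {F : Type*} [Field F]

/-- The matrix `A` as the linear map `x ↦ x ᵥ* A`. -/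
noncomputable def rowLinear {m n : ℕ} :
    Matrix (Fin m) (Fin n) F ≃ₗ[F] (Fin m → F) →ₗ[F] (Fin n → F) :=
  (Matrix.transposeLinearEquiv (Fin m) (Fin n) F F).trans Matrix.toLin'

theorem rowLinear_apply {m n : ℕ} (A : Matrix (Fin m) (Fin n) F) (x : Fin m → F) :
    rowLinear A x = Matrix.vecMul x A :=
  Matrix.mulVec_transpose A x

theorem rank_add_finrank_ker_rowLinear {m n : ℕ} (A : Matrix (Fin m) (Fin n) F) :
    A.rank + finrank F (LinearMap.ker (rowLinear A)) = m := by
  rw [← Matrix.rank_transpose]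
  exact (LinearMap.finrank_range_add_finrank_ker (rowLinear A)).trans (finrank_fin_fun F)

/-- Concatenation of a vector of length `k` with a vector of length `v - k`. -/
def appendEquiv (F : Type*) [Field F] {v k : ℕ} (h : k ≤ v) :
    ((Fin k → F) × (Fin (v - k) → F)) ≃ₗ[F] (Fin v → F) where
  toFun p j := if h : (j : ℕ) < k then p.1 ⟨j, h⟩
    else p.2 ⟨(j : ℕ) - k, by have := j.isLt; omega⟩
  map_add' p p' := by
    ext j
    by_cases hj : (j : ℕ) < k <;> simp [hj]
  map_smul' c p := by
    ext j
    by_cases hj : (j : ℕ) < k <;> simp [hj]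
  invFun x := (fun i => x ⟨i, by omega⟩, fun i => x ⟨i + k, by omega⟩)
  left_inv p := by
    ext i <;> simp
  right_inv x := by
    ext j
    by_cases hj : (j : ℕ) < k
    · simp [hj]
    · simp [hj, Nat.sub_add_cancel (not_lt.1 hj)]

theorem rowspan_prefixIdentity {v k : ℕ} (h : k ≤ v) (A : Matrix (Fin k) (Fin (v - k)) F) :
    rowspan (prefixIdentity A) = (rowLinear A).graph.map (appendEquiv F h).toLinearMap := by
  have hrow : rowspan (prefixIdentity A) = LinearMap.range (prefixIdentity A).vecMulLinear :=
    (range_vecMulLinear _).symm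
  rw [hrow, LinearMap.graph_eq_range_prod, ← LinearMap.range_comp]
  congr 1
  refine LinearMap.pi_ext' fun i => LinearMap.ext_ring ?_
  ext j
  simp [rowLinear_apply, appendEquiv, prefixIdentity, Matrix.one_apply, Pi.single_apply, eq_comm]

theorem setOf_rowspan_eq_image {v k : ℕ} (h : k ≤ v)
    (M : Submodule F (Matrix (Fin k) (Fin (v - k)) F)) :
    {U | ∃ A ∈ M, U = rowspan (prefixIdentity A)} =
      (fun f : (Fin k → F) →ₗ[F] (Fin (v - k) → F) =>
        f.graph.map (appendEquiv F h).toLinearMap) '' (M.map rowLinear.toLinearMap) := by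
  ext U
  constructor
  · rintro ⟨A, hA, rfl⟩
    exact ⟨_, ⟨A, hA, rfl⟩, (rowspan_prefixIdentity h A).symm⟩
  · rintro ⟨_, ⟨A, hA, rfl⟩, rfl⟩
    exact ⟨A, hA, (rowspan_prefixIdentity h A).symm⟩

/-- With `3 * l` rows, rank at least `2 * l` means kernel dimension at most `l`. The exponent is a
natural number here, so the ceiling has no effect. Keeping `n` separate allows `n` to be `6 * l - 3
* l`. -/
theorem isMRD_iff [Finite F] {l n : ℕ} (hn : n = 3 * l)
    (M : Submodule F (Matrix (Fin (3 * l)) (Fin n) F)) :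
    IsMRD M (4 * l / 2) ↔ finrank F (M.map rowLinear.toLinearMap) = (l + 1) * n ∧
      ∀ f ∈ M.map rowLinear.toLinearMap, f ≠ 0 → finrank F (LinearMap.ker f) < l + 1 := by
  subst hn
  rw [IsMRD, and_comm]
  refine and_congr ?_ ?_
  · rw [LinearEquiv.finrank_map_eq, Module.natCard_eq_pow_finrank (K := F), max_self, min_self,
      show ((3 * l : ℕ) : ℤ) * (((3 * l : ℕ) : ℤ) - ((4 * l / 2 : ℕ) : ℤ) + 1) =
        (((l + 1) * (3 * l) : ℕ) : ℤ) by
          rw [show 4 * l / 2 = 2 * l by omega]; push_cast; ring,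
      zpow_natCast, ← Nat.cast_pow, Nat.ceil_natCast]
    exact Nat.pow_right_inj Finite.one_lt_card
  · have hdim (A : Matrix (Fin (3 * l)) (Fin (3 * l)) F) :
        4 * l / 2 ≤ A.rank ↔ finrank F (LinearMap.ker (rowLinear A)) < l + 1 := by
      have := rank_add_finrank_ker_rowLinear A
      omega
    constructor
    · rintro h _ ⟨A, hA, rfl⟩ hne
      have := h A hA 0 M.zero_mem (by rintro rfl; simp at hne)
      rw [sub_zero] at this
      exact (hdim A).1 this
    · intro h A hA B hB hne
      refine (hdim _).2 (h _ ⟨_, M.sub_mem hA hB, rfl⟩ ?_)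
      simpa [sub_eq_zero] using hne

end Matrix

/-! ### Code sizes, the upper bound and the construction. -/

theorem ncard_image_graph {F A B V : Type*} [Field F] [AddCommGroup A] [Module F A]
    [FiniteDimensional F A] [AddCommGroup B] [Module F B] [FiniteDimensional F B]
    [AddCommGroup V] [Module F V]
    (e : (A × B) ≃ₗ[F] V) (M : Submodule F (A →ₗ[F] B)) :
    ((fun f : A →ₗ[F] B => f.graph.map e.toLinearMap) '' M).ncard = Nat.card F ^ finrank F M := by
  rw [Set.ncard_image_of_injective, ← Nat.card_coe_set_eq]
  · exact Module.natCard_eq_pow_finrank (V := M)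
  · intro f g h
    have h' : f.graph = g.graph := Submodule.map_injective_of_injective e.injective h
    ext x
    have hx : (x, f x) ∈ f.graph := rfl
    rw [h'] at hx
    exact hx

variable {F : Type*} [Field F] [Finite F]

theorem maxCDCSize_eq {l n : ℕ} (hl : 1 ≤ l) (hn : n = 3 * l) :
    maxCDCSize F n (2 * l) (2 * l) = Nat.card F ^ (2 * l) + Nat.card F ^ l + 1 := by
  have hV : finrank F (Fin n → F) = 3 * l := by rw [finrank_fin_fun, hn]
  apply le_antisymm
  · obtain ⟨D, hD⟩ := (isGreatest_maxCDCSize F n (2 * l) (2 * l)).1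
    rw [← hD.ncard_eq]
    refine ncard_le_of_finrank_inf_le hl hV D hD.finrank_eq fun U hU W hW hne => ?_
    have := (le_subspaceDist_iff (hD.finrank_eq U hU) (hD.finrank_eq W hW)).1
      (hD.le_dist U hU W hW hne)
    omega
  -- Dually to the upper bound, an `l`-spread of the dual space has coannihilators of dimension `2 *
  -- l` meeting pairwise in dimension `l`.
  · obtain ⟨ι, Q, _, hcard, hQ, hdisj⟩ :=
      exists_spread (F := F) (V := Dual F (Fin n → F)) hl (Subspace.dual_finrank_eq.trans hV)
    have hfin (i : ι) : finrank F (Q i).dualCoannihilator = 2 * l := by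
      have := Subspace.finrank_add_finrank_dualCoannihilator_eq (Q i)
      rw [hQ] at this
      omega
    have hinf (i j : ι) (hij : i ≠ j) :
        finrank F ↥((Q i).dualCoannihilator ⊓ (Q j).dualCoannihilator) = l := by
      rw [← Submodule.dualCoannihilator_sup_eq]
      have h1 := Subspace.finrank_add_finrank_dualCoannihilator_eq (Q i ⊔ Q j)
      have h2 := Submodule.finrank_sup_add_finrank_inf_eq (Q i) (Q j)
      rw [hQ, hQ, (hdisj i j hij).eq_bot, finrank_bot] at h2
      omega
    have hinj : Function.Injective fun i => (Q i).dualCoannihilator := by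
      intro i j h
      by_contra hij
      have h1 := hinf i j hij
      dsimp only at h
      rw [← h, inf_idem, hfin] at h1
      omega
    refine (isGreatest_maxCDCSize F n (2 * l) (2 * l)).2
      ⟨Set.range fun i => (Q i).dualCoannihilator, ?_, ?_, ?_⟩
    · rw [Set.ncard_range_of_injective hinj, hcard]
    · rintro _ ⟨i, rfl⟩
      exact hfin i
    · rintro _ ⟨i, rfl⟩ _ ⟨j, rfl⟩ hne
      refine (le_subspaceDist_iff (hfin i) (hfin j)).2 ?_
      rw [hinf i j fun h => hne (by rw [h])]
      omega

theorem lmrdBound_eq {l : ℕ} (hl : 1 ≤ l) :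
    lmrdBound F (6 * l) (4 * l) (3 * l) =
      Nat.card F ^ (3 * l * (l + 1)) + (Nat.card F ^ (2 * l) + Nat.card F ^ l + 1) := by
  rw [lmrdBound, show 4 * l / 2 = 2 * l by omega, show 2 * (4 * l - 3 * l) = 2 * l by omega,
    maxCDCSize_eq hl (by omega), show 6 * l - 3 * l = 3 * l by omega,
    show 3 * l - 2 * l + 1 = l + 1 by omega]

theorem le_lmrdBound {l N : ℕ} {C : Set (Submodule F (Fin (6 * l) → F))}
    (hl : 1 ≤ l) (hC : IsCDC F (6 * l) N (4 * l) (3 * l) C)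
    (hL : ContainsLMRD F (6 * l) (4 * l) (3 * l) C) :
    N ≤ lmrdBound F (6 * l) (4 * l) (3 * l) := by
  obtain ⟨L, ⟨M, hM, rfl⟩, hLC⟩ := hL
  have hk : 3 * l ≤ 6 * l := by omega
  have hn : 6 * l - 3 * l = 3 * l := by omega
  obtain ⟨hdim, hker⟩ := (isMRD_iff hn M).1 hM
  rw [setOf_rowspan_eq_image hk] at hLC
  set M' := M.map rowLinear.toLinearMap
  set e := appendEquiv F hk
  set L := (fun f : (Fin (3 * l) → F) →ₗ[F] (Fin (6 * l - 3 * l) → F) =>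
    f.graph.map e.toLinearMap) '' M'
  have hLcard : L.ncard = Nat.card F ^ (3 * l * (l + 1)) := by
    rw [ncard_image_graph, hdim, hn, mul_comm]
  have hinf (U) (hU : U ∈ C) (W) (hW : W ∈ C) (hne : U ≠ W) : finrank F ↥(U ⊓ W) ≤ l := by
    have := (le_subspaceDist_iff (hC.finrank_eq U hU) (hC.finrank_eq W hW)).1
      (hC.le_dist U hU W hW hne)
    omega
  -- The part of `W` inside `0 × B`, as a subspace of `B`.
  let σ (W : Submodule F (Fin (6 * l) → F)) : Submodule F (Fin (6 * l - 3 * l) → F) :=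
    (W.map e.symm.toLinearMap).comap (LinearMap.inr F _ _)
  have hσ (W) (hW : W ∈ C \ L) : 2 * l ≤ finrank F (σ W) := by
    have := finrank_lt_add_finrank_comap_inr (t := l + 1) (M := M')
      (by rw [hdim, finrank_fin_fun]) hker (W := W.map e.symm.toLinearMap) (by
        intro f hf
        have hfL : f.graph.map e.toLinearMap ∈ L := ⟨f, hf, rfl⟩
        have h := hinf _ (hLC hfL) W hW.1 fun h => hW.2 (h ▸ hfL)
        rw [← finrank_map_equiv_inf e.symm] at h
        have hf' : (f.graph.map e.toLinearMap).map e.symm.toLinearMap = f.graph := by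
          ext x
          simp [Submodule.mem_map_equiv]
        rw [hf'] at h
        omega)
    rw [LinearEquiv.finrank_map_eq, hC.finrank_eq W hW.1] at this
    change _ < _ + finrank F (σ W) at this
    omega
  have hσinf (U W : Submodule F (Fin (6 * l) → F)) :
      finrank F ↥(σ U ⊓ σ W) ≤ finrank F ↥(U ⊓ W) := by
    rw [← finrank_map_equiv_inf e.symm, ← Submodule.comap_inf, finrank_comap_inr]
    exact Submodule.finrank_mono inf_le_left
  -- Cutting down to dimension exactly `2 * l` makes the dual counting bound apply; `P` stays
  -- injective because `l < 2 * l`.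
  choose! P hPσ hP using fun W (hW : W ∈ C \ L) => exists_le_finrank_eq (σ W) (hσ W hW)
  have hPinf (U) (hU : U ∈ C \ L) (W) (hW : W ∈ C \ L) (hne : U ≠ W) :
      finrank F ↥(P U ⊓ P W) ≤ l :=
    (Submodule.finrank_mono (inf_le_inf (hPσ U hU) (hPσ W hW))).trans
      ((hσinf U W).trans (hinf U hU.1 W hW.1 hne))
  have hPinj : Set.InjOn P (C \ L) := by
    intro U hU W hW h
    by_contra hne
    have := hPinf U hU W hW hne
    rw [← h, inf_idem, hP U hU] at this
    omega
  have : Finite (Submodule F (Fin (6 * l) → F)) :=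
    Finite.of_injective _ SetLike.coe_injective
  have hrest : (C \ L).ncard ≤ Nat.card F ^ (2 * l) + Nat.card F ^ l + 1 := by
    rw [← hPinj.ncard_image]
    refine ncard_le_of_finrank_inf_le hl ((finrank_fin_fun F).trans hn) _ ?_ ?_
    · rintro _ ⟨W, hW, rfl⟩
      exact hP W hW
    · rintro _ ⟨U, hU, rfl⟩ _ ⟨W, hW, rfl⟩ hne
      exact hPinf U hU W hW fun h => hne (by rw [h])
  rw [lmrdBound_eq hl, ← hC.ncard_eq, ← Set.ncard_sdiff_add_ncard_of_subset hLC, hLcard]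
  omega

theorem exists_isCDC_containsLMRD {l : ℕ} (hl : 1 ≤ l) :
    ∃ C : Set (Submodule F (Fin (6 * l) → F)),
      IsCDC F (6 * l) (Nat.card F ^ (3 * l * (l + 1)) + Nat.card F ^ (2 * l) + Nat.card F ^ l + 1)
        (4 * l) (3 * l) C ∧ ContainsLMRD F (6 * l) (4 * l) (3 * l) C := by
  have hk : 3 * l ≤ 6 * l := by omega
  have hn : 6 * l - 3 * l = 3 * l := by omega
  have hA : finrank F (Fin (3 * l) → F) = 3 * l := finrank_fin_fun F
  have hB : finrank F (Fin (6 * l - 3 * l) → F) = 3 * l := (finrank_fin_fun F).trans hn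
  obtain ⟨M', hdim, hker⟩ := exists_submodule_finrank_ker_lt (F := F) (t := l + 1) (by omega)
    hA hB (by omega)
  obtain ⟨M, rfl⟩ : ∃ M : Submodule F (Matrix (Fin (3 * l)) (Fin (6 * l - 3 * l)) F),
      M.map rowLinear.toLinearMap = M' :=
    ⟨_, Submodule.map_comap_eq_of_surjective rowLinear.surjective M'⟩
  have hM : IsMRD M (4 * l / 2) := (isMRD_iff hn M).2 ⟨by rw [hdim, hn], hker⟩
  obtain ⟨ι, Q, _, hcard, hQ, hdisj⟩ := exists_spread (F := F) hl hA
  -- Any isomorphism will do, since only dimensions inside `B` matter.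
  let d : Dual F (Fin (3 * l) → F) ≃ₗ[F] (Fin (6 * l - 3 * l) → F) :=
    LinearEquiv.ofFinrankEq _ _ ((Subspace.dual_finrank_eq.trans hA).trans hB.symm)
  let W (i : ι) : Submodule F ((Fin (3 * l) → F) × (Fin (6 * l - 3 * l) → F)) :=
    (Q i).prod ((Q i).dualAnnihilator.map d.toLinearMap)
  have hann (U : Submodule F (Fin (3 * l) → F)) :=
    Subspace.finrank_add_finrank_dualAnnihilator_eq (K := F) U
  have hW (i : ι) : finrank F (W i) = 3 * l := by
    rw [finrank_submodule_prod, LinearEquiv.finrank_map_eq, hann, hA]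
  have hWinf (i j : ι) (hij : i ≠ j) : finrank F ↥(W i ⊓ W j) = l := by
    have h1 := hann (Q i ⊔ Q j)
    have h2 := Submodule.finrank_sup_add_finrank_inf_eq (Q i) (Q j)
    rw [hQ, hQ, (hdisj i j hij).eq_bot, finrank_bot] at h2
    rw [Submodule.prod_inf_prod, (hdisj i j hij).eq_bot, finrank_submodule_prod, finrank_bot,
      finrank_map_equiv_inf, ← Submodule.dualAnnihilator_sup_eq]
    omega
  have hgraphW (f : (Fin (3 * l) → F) →ₗ[F] (Fin (6 * l - 3 * l) → F)) (i : ι) :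
      finrank F ↥(f.graph ⊓ W i) ≤ l := by
    have hmaps : ∀ x ∈ f.graph ⊓ W i, LinearMap.fst F _ _ x ∈ Q i := fun x hx => hx.2.1
    -- A point of a graph is determined by its first coordinate, which here lies in the `l`-space `Q
    -- i`.
    have hinj : Function.Injective ((LinearMap.fst F _ _).restrict hmaps) := by
      rintro ⟨x, hx⟩ ⟨y, hy⟩ h
      have h1 : x.1 = y.1 := congrArg Subtype.val h
      have hxf : x.2 = f x.1 := hx.1
      have hyf : y.2 = f y.1 := hy.1
      exact Subtype.ext (Prod.ext h1 (by rw [hxf, hyf, h1]))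
    exact (LinearMap.finrank_le_finrank_of_injective hinj).trans (hQ i).le
  let e := appendEquiv F hk
  let L := (fun f : (Fin (3 * l) → F) →ₗ[F] (Fin (6 * l - 3 * l) → F) =>
    f.graph.map e.toLinearMap) '' (M.map rowLinear.toLinearMap)
  let R := Set.range fun i => (W i).map e.toLinearMap
  have hinjR : Function.Injective fun i => (W i).map e.toLinearMap := by
    intro i j h
    by_contra hij
    have h1 := hWinf i j hij
    have h2 : W i = W j := Submodule.map_injective_of_injective e.injective h
    rw [← h2, inf_idem, hW] at h1
    omega
  have hLR : Disjoint L R := by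
    rw [Set.disjoint_left]
    rintro _ ⟨f, hf, rfl⟩ ⟨i, h⟩
    have h1 := hgraphW f i
    have h2 : W i = f.graph := Submodule.map_injective_of_injective e.injective h
    rw [← h2, inf_idem, hW] at h1
    omega
  have : Finite (Submodule F (Fin (6 * l) → F)) :=
    Finite.of_injective _ SetLike.coe_injective
  have hfinL : ∀ U ∈ L, finrank F U = 3 * l := by
    rintro _ ⟨f, hf, rfl⟩
    dsimp only
    rw [LinearEquiv.finrank_map_eq, finrank_graph, hA]
  have hfinR : ∀ U ∈ R, finrank F U = 3 * l := by
    rintro _ ⟨i, rfl⟩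
    dsimp only
    rw [LinearEquiv.finrank_map_eq, hW]
  have hfin : ∀ U ∈ L ∪ R, finrank F U = 3 * l := by
    rintro U (hU | hU)
    exacts [hfinL U hU, hfinR U hU]
  refine ⟨L ∪ R, ⟨?_, hfin, ?_⟩, L, ⟨M, hM, (setOf_rowspan_eq_image hk M).symm⟩,
    Set.subset_union_left⟩
  · rw [Set.ncard_union_eq hLR, ncard_image_graph, hdim, Set.ncard_range_of_injective hinjR, hcard,
      mul_comm (l + 1)]
    ring
  · intro U hU U' hU' hne
    rw [le_subspaceDist_iff (hfin U hU) (hfin U' hU')]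
    suffices finrank F ↥(U ⊓ U') ≤ l by omega
    rcases hU with ⟨f, hf, rfl⟩ | ⟨i, rfl⟩ <;> rcases hU' with ⟨g, hg, rfl⟩ | ⟨j, rfl⟩ <;>
      rw [finrank_map_equiv_inf]
    · rw [finrank_graph_inf_graph]
      refine Nat.le_of_lt_succ (hker _ (Submodule.sub_mem _ hf hg) ?_)
      rw [sub_ne_zero]
      rintro rfl
      exact hne rfl
    · exact hgraphW f j
    · rw [inf_comm]
      exact hgraphW g i
    · exact (hWinf i j fun h => hne (by rw [h])).le

end SubspaceCode

theorem mainTheorem4 (q l : ℕ) (hq : IsPrimePow q) (hl : 1 ≤ l)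
    (F : Type*) [Field F] [Finite F] (hF : Nat.card F = q) :
    (∃ C : Set (Submodule F (Fin (6 * l) → F)),
      SubspaceCode.IsCDC F (6 * l) (q ^ (3 * l * (l + 1)) + q ^ (2 * l) + q ^ l + 1)
        (4 * l) (3 * l) C ∧
      SubspaceCode.ContainsLMRD F (6 * l) (4 * l) (3 * l) C) ∧
    q ^ (3 * l * (l + 1)) + q ^ (2 * l) + q ^ l + 1
      = SubspaceCode.lmrdBound F (6 * l) (4 * l) (3 * l) ∧
    (∀ (N : ℕ) (C : Set (Submodule F (Fin (6 * l) → F))),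
      SubspaceCode.IsCDC F (6 * l) N (4 * l) (3 * l) C →
      SubspaceCode.ContainsLMRD F (6 * l) (4 * l) (3 * l) C →
      N ≤ SubspaceCode.lmrdBound F (6 * l) (4 * l) (3 * l)) := by
  subst hF
  refine ⟨SubspaceCode.exists_isCDC_containsLMRD hl, ?_,
    fun N C hC hL => SubspaceCode.le_lmrdBound hl hC hL⟩
  rw [SubspaceCode.lmrdBound_eq hl]
  ring
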